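/- Let $\mathcal X$ be a finite set, $r:\mathcal X\to(0,\infty)$ a strictly positive reference measure and $A$ a real $h\times|\mathcal X|$ matrix (columns indexed by $\mathcal X$) whose row span contains the constant vector $(1,\dots,1)$. Let $\mathcal E$ be the exponential family consisting of all probability measures $$P_\theta(x)=\frac{r(x)}{Z_\theta}\exp\Big(\sum_{i=1}^h\theta_iA_{i,x}\Big),\qquad Z_\theta=\sum_{y\in\mathcal X}r(y)\exp\Big(\sum_{i=1}^h\theta_iA_{i,y}\Big),\qquad \theta\in\mathbb R^h.$$ For probability measures $P,Q$ on $\mathcal X$ let $D(P\|Q)=\sum_xP(x)\log\frac{P(x)}{Q(x)}$ (with $0\log0=0\log(0/0)=0$, and $D(P\|Q)=\infty$ if $\operatorname{supp}P\not\subseteq\operatorname{supp}Q$), and let $D(P\|\mathcal E)=\inf_{Q\in\mathcal E}D(P\|Q)$. Maximizers of $D(\cdot\|\mathcal E)$, global or local, are meant over the set of all probability measures on $\mathcal X$. For $u\in\ker A$ let $\overline D_r(u)=\sum_xu(x)\log\frac{|u(x)|}{r(x)}$ (with $0\log 0=0$). Maximizers of $\overline D_r$, global or local, are meant over the set of all $u\in\ker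 A$ with $\frac12\|u\|_1=\frac12\sum_x|u(x)|=1$. 1. If $u=Q_+-Q_-$ (with $Q_+$ and $Q_-$ the positive and negative part of $u$) is a global maximizer of $\overline D_r$ over $\{u\in\ker A:\frac12\|u\|_1=1\}$, then $Q_+$ is a probability measure and globally maximizes $D(\cdot\|\mathcal E)$. 2. Suppose $\ker A\neq\{0\}$, and let $P_+$ be a local maximizer of $D(\cdot\|\mathcal E)$. Then there exists a unique probability measure $P_-$ whose support is disjoint from that of $P_+$ such that $P_+-P_-$ lies in $\ker A$ and is a local maximizer of $\overline D_r$ over $\{u\in\ker A:\frac12\|u\|_1=1\}$. If $P_+$ is moreover a global maximizer of $D(\cdot\|\mathcal E)$, then $P_+-P_-$ is a global maximizer of $\overline D_r$ over this set. -/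

import Mathlib

namespace ExpFamily

noncomputable section

/-- The probability measure `P_θ(x) = r(x) / Z_θ * exp (∑ i, θ i * A i x)` on the finite set `X`,
where `Z_θ = ∑ y, r(y) * exp (∑ i, θ i * A i y)` is the normalizing constant. -/
def gibbs {X : Type*} [Fintype X] {h : ℕ} (A : Matrix (Fin h) X ℝ) (r : X → ℝ)
    (θ : Fin h → ℝ) : X → ℝ :=
  fun x => r x / (∑ y, r y * Real.exp (∑ i, θ i * A i y)) * Real.exp (∑ i, θ i * A i x)

/-- The exponential family with sufficient statistics `A` and reference measure `r`. -/
def family {X : Type*} [Fintype X] {h : ℕ} (A : Matrix (Fin h) X ℝ) (r : X → ℝ) :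
    Set (X → ℝ) :=
  Set.range (gibbs A r)

open Classical in
/-- The information divergence `D(P‖Q)`, with `0 log 0 = 0 log (0/0) = 0`, infinite if the support
of `P` is not contained in the support of `Q`. -/
def infDiv {X : Type*} [Fintype X] (P Q : X → ℝ) : EReal :=
  if Function.support P ⊆ Function.support Q then
    ((∑ x, P x * Real.log (P x / Q x) : ℝ) : EReal)
  else ⊤

/-- `D(P‖𝓔) = inf_{Q ∈ 𝓔} D(P‖Q)`. -/
def infDivFrom {X : Type*} [Fintype X] (E : Set (X → ℝ)) (P : X → ℝ) : EReal :=
  ⨅ Q ∈ E, infDiv P Q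

/-- `u ↦ ∑ x, u(x) log (|u(x)| / r(x))`, with `0 log 0 = 0`. -/
def dBar {X : Type*} [Fintype X] (r : X → ℝ) (u : X → ℝ) : ℝ :=
  ∑ x, u x * Real.log (|u x| / r x)

/-- The vectors `u ∈ ker A` of degree `d_u = ‖u‖₁ / 2 = 1`. -/
def kerSphere {X : Type*} [Fintype X] {h : ℕ} (A : Matrix (Fin h) X ℝ) : Set (X → ℝ) :=
  {u | u ∈ LinearMap.ker A.mulVecLin ∧ (1 / 2 : ℝ) * ∑ x, |u x| = 1}

/-- `P` is a global maximizer of `D(·‖E)` over the set of all probability measures on `X`. -/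
def IsGlobalMaxDiv {X : Type*} [Fintype X] (E : Set (X → ℝ)) (P : X → ℝ) : Prop :=
  P ∈ stdSimplex ℝ X ∧ IsMaxOn (infDivFrom E) (stdSimplex ℝ X) P

/-- `P` is a local maximizer of `D(·‖E)` over the set of all probability measures on `X`. -/
def IsLocalMaxDiv {X : Type*} [Fintype X] (E : Set (X → ℝ)) (P : X → ℝ) : Prop :=
  P ∈ stdSimplex ℝ X ∧ IsLocalMaxOn (infDivFrom E) (stdSimplex ℝ X) P

/-- `u` is a global maximizer of `dBar r` over `ker A` subject to `d_u = 1`. -/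
def IsGlobalMaxDBar {X : Type*} [Fintype X] {h : ℕ} (A : Matrix (Fin h) X ℝ) (r : X → ℝ)
    (u : X → ℝ) : Prop :=
  u ∈ kerSphere A ∧ IsMaxOn (dBar r) (kerSphere A) u

/-- `u` is a local maximizer of `dBar r` over `ker A` subject to `d_u = 1`. -/
def IsLocalMaxDBar {X : Type*} [Fintype X] {h : ℕ} (A : Matrix (Fin h) X ℝ) (r : X → ℝ)
    (u : X → ℝ) : Prop :=
  u ∈ kerSphere A ∧ IsLocalMaxOn (dBar r) (kerSphere A) u

/-- `Pm` is a probability measure with support disjoint from that of `Pp` such that `Pp - Pm` lies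
in `ker A` and is a local maximizer of `dBar r` subject to `d_u = 1`. -/
def IsPartner {X : Type*} [Fintype X] {h : ℕ} (A : Matrix (Fin h) X ℝ) (r : X → ℝ)
    (Pp Pm : X → ℝ) : Prop :=
  Pm ∈ stdSimplex ℝ X ∧ Disjoint (Function.support Pp) (Function.support Pm) ∧
    IsLocalMaxDBar A r (Pp - Pm)

end

end ExpFamily

open Filter Topology

namespace ExpFamily

section

variable {X : Type*} [Fintype X]

/-! On nonnegative vectors `dBar r` is the strictly convex relative entropy with respect to `r`. By
duality `D(P‖𝓔)` is the largest value of `dBar r P - dBar r Q` over probability measures `Q` with `P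
- Q ∈ ker A` (`dBar_sub_dBar_le_infDivFrom`, `exists_infDivFrom_eq`).

Everything then rests on comparing `D` with `log (1 + exp (dBar r u))`. For `u` on the sphere, a
mixture of `u⁺` and `u⁻` as `Q` gives `log (1 + exp (dBar r u)) ≤ D(u⁺‖𝓔)`. Conversely, for `P ≠ Q`
in one fiber, `dBar r P - dBar r Q` is at most this expression at the normalized difference of `P`
and `Q` (`exists_mem_kerSphere_dBar_sub_le`). The two bounds give part 1.

For part 2, stationarity at a local maximizer `P` forces the optimal `Q` to be proportional to `P`
on the support of `P`; the rest of `Q`, normalized, is the partner, and the lower bound becomes an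
equality (`exists_partner_infDivFrom_eq`). Since the lower bound holds on the whole sphere and `u ↦
u⁺` is continuous, maximality passes from `D` to `dBar r`. Uniqueness is strict convexity on the
segment between two partners. -/

/-! ### The functional `dBar r`: algebra, convexity, derivative -/

/-- `Real.log` is even, so the absolute value can be dropped and each term becomes `t log t` minus a
linear function, also for negative entries. -/
theorem dBar_eq_sum {r : X → ℝ} (hr : ∀ x, 0 < r x) (u : X → ℝ) :
    dBar r u = ∑ x, (u x * Real.log (u x) - u x * Real.log (r x)) := by
  refine Finset.sum_congr rfl fun x _ => ?_
  rcases eq_or_ne (u x) 0 with h | h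
  · simp [h]
  · rw [Real.log_div (abs_ne_zero.2 h) (hr x).ne', Real.log_abs, mul_sub]

theorem continuous_dBar {r : X → ℝ} (hr : ∀ x, 0 < r x) : Continuous (dBar r) := by
  rw [funext (dBar_eq_sum hr)]
  refine continuous_finsetSum _ fun x _ => ?_
  exact (Real.continuous_mul_log.comp (continuous_apply x)).sub
    ((continuous_apply x).mul continuous_const)

theorem dBar_neg (r u : X → ℝ) : dBar r (-u) = -dBar r u := by
  simp [dBar, Finset.sum_neg_distrib]

theorem dBar_smul {r : X → ℝ} (hr : ∀ x, 0 < r x) (c : ℝ) (u : X → ℝ) :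
    dBar r (c • u) = c * dBar r u + c * Real.log c * ∑ x, u x := by
  rw [dBar_eq_sum hr, dBar_eq_sum hr, Finset.mul_sum, Finset.mul_sum, ← Finset.sum_add_distrib]
  refine Finset.sum_congr rfl fun x _ => ?_
  rcases eq_or_ne c 0 with h | h
  · simp [h]
  rcases eq_or_ne (u x) 0 with h' | h'
  · simp [h']
  · rw [Pi.smul_apply, smul_eq_mul, Real.log_mul h h']
    ring

theorem dBar_add_of_mul_eq_zero (r : X → ℝ) {u v : X → ℝ} (h : ∀ x, u x * v x = 0) :
    dBar r (u + v) = dBar r u + dBar r v := by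
  simp only [dBar]
  rw [← Finset.sum_add_distrib]
  refine Finset.sum_congr rfl fun x _ => ?_
  rcases mul_eq_zero.1 (h x) with h | h <;> simp [h]

theorem dBar_sub_of_mul_eq_zero (r : X → ℝ) {u v : X → ℝ} (h : ∀ x, u x * v x = 0) :
    dBar r (u - v) = dBar r u - dBar r v := by
  rw [sub_eq_add_neg, dBar_add_of_mul_eq_zero r (v := -v) (by simpa using h), dBar_neg]
  rfl

theorem strictConvexOn_dBar {r : X → ℝ} (hr : ∀ x, 0 < r x) :
    StrictConvexOn ℝ {u : X → ℝ | ∀ x, 0 ≤ u x} (dBar r) := by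
  refine ⟨fun u hu v hv a b ha hb _ x => ?_, fun u hu v hv huv a b ha hb hab => ?_⟩
  · have := mul_nonneg ha (hu x)
    have := mul_nonneg hb (hv x)
    simp only [Pi.add_apply, Pi.smul_apply, smul_eq_mul]
    linarith
  · simp only [dBar_eq_sum hr, smul_eq_mul, Finset.mul_sum]
    rw [← Finset.sum_add_distrib]
    obtain ⟨y, hy⟩ := Function.ne_iff.1 huv
    refine Finset.sum_lt_sum (fun x _ => ?_) ⟨y, Finset.mem_univ _, ?_⟩
    · have := Real.convexOn_mul_log.2 (hu x) (hv x) ha.le hb.le hab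
      simp only [Pi.add_apply, Pi.smul_apply, smul_eq_mul] at *
      linarith
    · have := Real.strictConvexOn_mul_log.2 (hu y) (hv y) hy ha hb hab
      simp only [Pi.add_apply, Pi.smul_apply, smul_eq_mul] at *
      linarith

/-- The infinite slope of `t log t` at `0` is harmless because `v` vanishes wherever `u` does; this
allows first-order conditions on the boundary of the simplex. -/
theorem hasDerivAt_dBar {r : X → ℝ} (hr : ∀ x, 0 < r x) (u v : X → ℝ)
    (huv : ∀ x, u x = 0 → v x = 0) :
    HasDerivAt (fun s : ℝ => dBar r (u + s • v))
      (∑ x, v x * (Real.log (u x) - Real.log (r x) + 1)) 0 := by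
  simp only [dBar_eq_sum hr]
  refine HasDerivAt.fun_sum fun x _ => ?_
  have h1 : HasDerivAt (fun s : ℝ => (u + s • v) x) (v x) 0 := by
    simpa using ((hasDerivAt_id (0 : ℝ)).mul_const (v x)).const_add (u x)
  rcases eq_or_ne (u x) 0 with h | h
  · simpa [h, huv x h] using hasDerivAt_const (0 : ℝ) (0 : ℝ)
  · have h2 : HasDerivAt (fun t : ℝ => t * Real.log t) (Real.log (u x) + 1)
        ((u + (0 : ℝ) • v) x) := by
      simpa using Real.hasDerivAt_mul_log h
    have h3 := (h2.comp 0 h1).sub (h1.mul_const (Real.log (r x)))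
    have e : (Real.log (u x) + 1) * v x - v x * Real.log (r x) =
        v x * (Real.log (u x) - Real.log (r x) + 1) := by ring
    rw [e] at h3
    exact h3

theorem eventually_add_smul_nonneg {u v : X → ℝ} (hu : ∀ x, 0 ≤ u x)
    (huv : ∀ x, u x = 0 → v x = 0) : ∀ᶠ s : ℝ in 𝓝 0, ∀ x, 0 ≤ (u + s • v) x := by
  rw [eventually_all]
  intro x
  rcases eq_or_lt_of_le (hu x) with h | h
  · simp [← h, huv x h.symm]
  · have : Continuous fun s : ℝ => (u + s • v) x := by
      simp only [Pi.add_apply, Pi.smul_apply, smul_eq_mul]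
      fun_prop
    have := this.tendsto 0
    simp only [zero_smul, add_zero] at this
    filter_upwards [this.eventually (lt_mem_nhds h)] with s hs using hs.le

/-! ### Scalar entropy inequalities -/

theorem sub_le_mul_log_div {a b : ℝ} (ha : 0 ≤ a) (hb : 0 < b) :
    a - b ≤ a * Real.log (a / b) := by
  rcases eq_or_lt_of_le ha with rfl | ha
  · simpa using hb.le
  · have h := Real.one_sub_inv_le_log_of_pos (div_pos ha hb)
    have := mul_le_mul_of_nonneg_left h ha.le
    refine le_trans (le_of_eq ?_) this
    field_simp

/-- Nonnegativity of the divergence of `(t, 1 - t)` from the two-point Gibbs measure with weights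
proportional to `exp d` and `1`. -/
theorem mul_add_entropy_le_log_one_add_exp (d : ℝ) {t : ℝ} (h0 : 0 ≤ t) (h1 : t ≤ 1) :
    t * d - t * Real.log t - (1 - t) * Real.log (1 - t) ≤ Real.log (1 + Real.exp d) := by
  have hE : 0 < 1 + Real.exp d := by positivity
  have h2 := sub_le_mul_log_div h0 (div_pos (Real.exp_pos d) hE)
  have h3 := sub_le_mul_log_div (sub_nonneg.2 h1) (inv_pos.2 hE)
  have e1 : t * Real.log (t / (Real.exp d / (1 + Real.exp d))) =
      t * Real.log t - t * d + t * Real.log (1 + Real.exp d) := by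
    rcases eq_or_ne t 0 with h | h
    · simp [h]
    · rw [Real.log_div h (by positivity), Real.log_div (by positivity) hE.ne', Real.log_exp]
      ring
  have e2 : (1 - t) * Real.log ((1 - t) / (1 + Real.exp d)⁻¹) =
      (1 - t) * Real.log (1 - t) + (1 - t) * Real.log (1 + Real.exp d) := by
    rcases eq_or_ne (1 - t) 0 with h | h
    · simp [h]
    · rw [Real.log_div h (by positivity), Real.log_inv]
      ring
  have e3 : Real.exp d / (1 + Real.exp d) + (1 + Real.exp d)⁻¹ = 1 := by
    field_simp
    ring
  rw [e1] at h2
  rw [e2] at h3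
  linarith

/-! ### Kernel, row span and the exponential family -/

variable {h : ℕ} {A : Matrix (Fin h) X ℝ} {r : X → ℝ}

theorem mem_ker_iff {v : X → ℝ} :
    v ∈ LinearMap.ker A.mulVecLin ↔ ∀ i, ∑ x, A i x * v x = 0 := by
  rw [LinearMap.mem_ker, Matrix.mulVecLin_apply, funext_iff]
  rfl

theorem sum_eq_zero_of_mem_ker
    (hA : (fun _ : X => (1 : ℝ)) ∈ Submodule.span ℝ (Set.range A.row)) {v : X → ℝ}
    (hv : v ∈ LinearMap.ker A.mulVecLin) : ∑ x, v x = 0 := by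
  have key : ∀ g ∈ Submodule.span ℝ (Set.range A.row), ∑ x, g x * v x = 0 := by
    intro g hg
    induction hg using Submodule.span_induction with
    | mem g hg =>
      obtain ⟨i, rfl⟩ := hg
      exact mem_ker_iff.1 hv i
    | zero => simp
    | add g g' _ _ h1 h2 => simp [add_mul, Finset.sum_add_distrib, h1, h2]
    | smul c g _ h1 => simp [mul_assoc, ← Finset.mul_sum, h1]
  simpa using key _ hA

/-- The range of the transpose is the annihilator of the kernel. -/
theorem exists_forall_eq_sum_mul {g : X → ℝ}
    (hg : ∀ v ∈ LinearMap.ker A.mulVecLin, ∑ x, v x * g x = 0) :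
    ∃ θ : Fin h → ℝ, ∀ x, g x = ∑ i, θ i * A i x := by
  classical
  let φ : Module.Dual ℝ (X → ℝ) := ∑ x, g x • LinearMap.proj x
  have hφ : φ ∈ LinearMap.range A.mulVecLin.dualMap := by
    rw [LinearMap.range_dualMap_eq_dualAnnihilator_ker, Submodule.mem_dualAnnihilator]
    intro v hv
    rw [← hg v hv]
    simp [φ, mul_comm]
  obtain ⟨ψ, hψ⟩ := hφ
  refine ⟨fun i => ψ (fun j => if i = j then 1 else 0), fun x => ?_⟩
  have h1 : φ (Pi.single x 1) = g x := by
    simp [φ, Pi.single_apply]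
  rw [← h1, ← hψ, LinearMap.dualMap_apply, LinearMap.pi_apply_eq_sum_univ ψ]
  simp [mul_comm]

theorem gibbs_pos (hr : ∀ x, 0 < r x) (θ : Fin h → ℝ) (x : X) : 0 < gibbs A r θ x := by
  have : 0 < ∑ y, r y * Real.exp (∑ i, θ i * A i y) :=
    Finset.sum_pos (fun y _ => mul_pos (hr y) (Real.exp_pos _)) ⟨x, Finset.mem_univ x⟩
  exact mul_pos (div_pos (hr x) this) (Real.exp_pos _)

theorem gibbs_mem_stdSimplex [Nonempty X] (hr : ∀ x, 0 < r x) (θ : Fin h → ℝ) :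
    gibbs A r θ ∈ stdSimplex ℝ X := by
  refine ⟨fun x => (gibbs_pos hr θ x).le, ?_⟩
  have : 0 < ∑ y, r y * Real.exp (∑ i, θ i * A i y) :=
    Finset.sum_pos (fun y _ => mul_pos (hr y) (Real.exp_pos _)) Finset.univ_nonempty
  simp only [gibbs, div_mul_eq_mul_div]
  rw [← Finset.sum_div, div_self this.ne']

/-- `log (P_θ / r)` is a combination of rows of `A` minus the constant `log Z`, and constants also
lie in the row span. -/
theorem sum_mul_log_gibbs_eq_zero (hr : ∀ x, 0 < r x)
    (hA : (fun _ : X => (1 : ℝ)) ∈ Submodule.span ℝ (Set.range A.row)) (θ : Fin h → ℝ)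
    {v : X → ℝ} (hv : v ∈ LinearMap.ker A.mulVecLin) :
    ∑ x, v x * Real.log (gibbs A r θ x / r x) = 0 := by
  set Z := ∑ y, r y * Real.exp (∑ i, θ i * A i y) with hZ
  have h1 : ∀ x, v x * Real.log (gibbs A r θ x / r x) =
      ∑ i, θ i * (A i x * v x) - v x * Real.log Z := by
    intro x
    have hZ0 : 0 < Z :=
      Finset.sum_pos (fun y _ => mul_pos (hr y) (Real.exp_pos _)) ⟨x, Finset.mem_univ x⟩
    have : gibbs A r θ x / r x = Real.exp (∑ i, θ i * A i x) / Z := by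
      have := (hr x).ne'
      rw [gibbs, ← hZ]
      field_simp
    rw [this, Real.log_div (Real.exp_pos _).ne' hZ0.ne', Real.log_exp, mul_sub, Finset.mul_sum]
    congr 1
    exact Finset.sum_congr rfl fun i _ => by ring
  simp only [h1, Finset.sum_sub_distrib, ← Finset.sum_mul, sum_eq_zero_of_mem_ker hA hv]
  rw [Finset.sum_comm]
  simp [← Finset.mul_sum, mem_ker_iff.1 hv]

theorem mem_family_of_pos (hr : ∀ x, 0 < r x) {Q : X → ℝ} (hQ : ∀ x, 0 < Q x)
    (hQ1 : ∑ x, Q x = 1)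
    (hker : ∀ v ∈ LinearMap.ker A.mulVecLin, ∑ x, v x * Real.log (Q x / r x) = 0) :
    Q ∈ family A r := by
  obtain ⟨θ, hθ⟩ := exists_forall_eq_sum_mul hker
  have h1 : ∀ x, r x * Real.exp (∑ i, θ i * A i x) = Q x := by
    intro x
    rw [← hθ, Real.exp_log (div_pos (hQ x) (hr x)), mul_div_cancel₀ _ (hr x).ne']
  refine ⟨θ, funext fun x => ?_⟩
  rw [gibbs]
  simp only [h1, hQ1, div_one]

theorem sum_mul_log_div_eq {P Q : X → ℝ} (hr : ∀ x, 0 < r x) (hP : ∀ x, 0 ≤ P x)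
    (hQ : ∀ x, 0 < Q x) :
    ∑ x, P x * Real.log (P x / Q x) = dBar r P - ∑ x, P x * Real.log (Q x / r x) := by
  rw [dBar_eq_sum hr, ← Finset.sum_sub_distrib]
  refine Finset.sum_congr rfl fun x _ => ?_
  rcases eq_or_lt_of_le (hP x) with h | h
  · simp [← h]
  · rw [Real.log_div h.ne' (hQ x).ne', Real.log_div (hQ x).ne' (hr x).ne']
    ring

theorem infDiv_gibbs (hr : ∀ x, 0 < r x) {P : X → ℝ} (hP : ∀ x, 0 ≤ P x) (θ : Fin h → ℝ) :
    infDiv P (gibbs A r θ) =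
      ((dBar r P - ∑ x, P x * Real.log (gibbs A r θ x / r x) : ℝ) : EReal) := by
  have hsupp : Function.support P ⊆ Function.support (gibbs A r θ) :=
    fun x _ => (gibbs_pos hr θ x).ne'
  rw [infDiv, if_pos hsupp, sum_mul_log_div_eq hr hP (gibbs_pos hr θ)]

/-- Nonnegativity of the divergence of a probability measure from a member of the family. -/
theorem sum_mul_log_gibbs_le_dBar (hr : ∀ x, 0 < r x) {P : X → ℝ} (hP : P ∈ stdSimplex ℝ X)
    (θ : Fin h → ℝ) : ∑ x, P x * Real.log (gibbs A r θ x / r x) ≤ dBar r P := by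
  rw [← sub_nonneg, ← sum_mul_log_div_eq hr hP.1 (gibbs_pos hr θ)]
  have : Nonempty X := by
    by_contra hX
    rw [not_nonempty_iff] at hX
    simpa using hP.2
  calc (0 : ℝ) = ∑ x, (P x - gibbs A r θ x) := by
        rw [Finset.sum_sub_distrib, hP.2, (gibbs_mem_stdSimplex hr θ).2, sub_self]
    _ ≤ _ := Finset.sum_le_sum fun x _ => sub_le_mul_log_div (hP.1 x) (gibbs_pos hr θ x)

/-! ### Duality for the divergence from the family -/

/-- For `G` in the family, `log (G / r)` has the same mean under `P` and `Q`, so `D(P‖G) = dBar r P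
- dBar r Q + D(Q‖G)`. -/
theorem dBar_sub_dBar_le_infDivFrom (hr : ∀ x, 0 < r x)
    (hA : (fun _ : X => (1 : ℝ)) ∈ Submodule.span ℝ (Set.range A.row)) {P Q : X → ℝ}
    (hP : P ∈ stdSimplex ℝ X) (hQ : Q ∈ stdSimplex ℝ X)
    (hPQ : P - Q ∈ LinearMap.ker A.mulVecLin) :
    ((dBar r P - dBar r Q : ℝ) : EReal) ≤ infDivFrom (family A r) P := by
  refine le_iInf₂ fun G hG => ?_
  obtain ⟨θ, rfl⟩ := hG
  rw [infDiv_gibbs hr hP.1, EReal.coe_le_coe_iff]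
  have h1 := sum_mul_log_gibbs_eq_zero hr hA θ hPQ
  simp only [Pi.sub_apply, sub_mul, Finset.sum_sub_distrib] at h1
  have h2 := sum_mul_log_gibbs_le_dBar (A := A) hr hQ θ
  linarith

/-- A minimizer of `dBar r` over a fiber in the probability simplex has maximal support. -/
theorem support_subset_of_forall_dBar_le (hr : ∀ x, 0 < r x) {P Q : X → ℝ}
    (hP : P ∈ stdSimplex ℝ X) (hQ : Q ∈ stdSimplex ℝ X)
    (hmin : ∀ s : ℝ, 0 < s → s < 1 → dBar r Q ≤ dBar r ((1 - s) • Q + s • P)) {x : X}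
    (hx : Q x = 0) : P x = 0 := by
  by_contra hPx
  have hPx : 0 < P x := lt_of_le_of_ne (hP.1 x) (Ne.symm hPx)
  -- Chosen so that `P x * log s` outweighs the difference of the two `dBar r` values: entering
  -- coordinate `x` from `0` has slope `-∞`.
  set s := Real.exp (-(|dBar r P - dBar r Q| + 1) / P x) with hs
  have hs0 : 0 < s := Real.exp_pos _
  have hs1 : s < 1 := by
    rw [hs, Real.exp_lt_one_iff]
    refine div_neg_of_neg_of_pos ?_ hPx
    have := abs_nonneg (dBar r P - dBar r Q)
    linarith
  have hlog : P x * Real.log s = -(|dBar r P - dBar r Q| + 1) := by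
    rw [hs, Real.log_exp, mul_div_cancel₀ _ hPx.ne']
  have key : dBar r ((1 - s) • Q + s • P) ≤
      (1 - s) * dBar r Q + s * dBar r P + s * (P x * Real.log s) := by
    classical
    have e : s * (P x * Real.log s) =
        ∑ y, if y = x then s * (P x * Real.log s) else 0 := by simp
    rw [e, dBar_eq_sum hr, dBar_eq_sum hr, dBar_eq_sum hr, Finset.mul_sum, Finset.mul_sum,
      ← Finset.sum_add_distrib, ← Finset.sum_add_distrib]
    refine Finset.sum_le_sum fun y _ => ?_
    simp only [Pi.add_apply, Pi.smul_apply, smul_eq_mul]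
    split_ifs with hy
    · subst hy
      rw [hx, mul_zero, zero_add, Real.log_mul hs0.ne' hPx.ne']
      apply le_of_eq
      ring
    · have := Real.convexOn_mul_log.2 (hQ.1 y) (hP.1 y) (sub_nonneg.2 hs1.le) hs0.le (by ring)
      simp only [smul_eq_mul] at this
      linarith
  have h1 := hmin s hs0 hs1
  rw [hlog] at key
  have h2 : 0 ≤ s * (dBar r P - dBar r Q + -(|dBar r P - dBar r Q| + 1)) := by linarith
  have h3 := nonneg_of_mul_nonneg_right h2 hs0
  have h4 := le_abs_self (dBar r P - dBar r Q)
  linarith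

/-- The minimizer of `dBar r` on the fiber of `P` has full support, and its stationarity says that
`log (Q / r)` annihilates `ker A`. -/
theorem exists_mem_family_sub_mem_ker (hr : ∀ x, 0 < r x)
    (hA : (fun _ : X => (1 : ℝ)) ∈ Submodule.span ℝ (Set.range A.row)) {P : X → ℝ}
    (hP : P ∈ stdSimplex ℝ X) (hP0 : ∀ x, 0 < P x) :
    ∃ θ, P - gibbs A r θ ∈ LinearMap.ker A.mulVecLin := by
  have hclosed : IsClosed {Q : X → ℝ | P - Q ∈ LinearMap.ker A.mulVecLin} :=
    (Submodule.closed_of_finiteDimensional (LinearMap.ker A.mulVecLin)).preimage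
      (continuous_const.sub continuous_id)
  obtain ⟨Q, ⟨hQ, hPQ⟩, hmin⟩ := ((isCompact_stdSimplex ℝ X).inter_right hclosed).exists_isMinOn
    ⟨P, hP, by simp⟩ (continuous_dBar hr).continuousOn
  have hQ0 : ∀ x, 0 < Q x := by
    intro x
    refine lt_of_le_of_ne (hQ.1 x) fun hx => (hP0 x).ne' ?_
    refine support_subset_of_forall_dBar_le hr hP hQ (fun s h0 h1 => hmin ⟨?_, ?_⟩) hx.symm
    · exact convex_stdSimplex ℝ X hQ hP (sub_nonneg.2 h1.le) h0.le (by ring)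
    · have : P - ((1 - s) • Q + s • P) = (1 - s) • (P - Q) := by module
      rw [Set.mem_ofPred_eq, this]
      exact Submodule.smul_mem _ _ hPQ
  have hfam : Q ∈ family A r := by
    refine mem_family_of_pos hr hQ0 hQ.2 fun v hv => ?_
    have hloc : IsLocalMin (fun s : ℝ => dBar r (Q + s • v)) 0 := by
      filter_upwards [eventually_add_smul_nonneg (v := v) hQ.1
        fun x hx => absurd hx (hQ0 x).ne'] with s hs
      simp only [zero_smul, add_zero]
      refine hmin ⟨⟨hs, ?_⟩, ?_⟩
      · simp [Finset.sum_add_distrib, ← Finset.mul_sum, sum_eq_zero_of_mem_ker hA hv, hQ.2]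
      · have : P - (Q + s • v) = (P - Q) - s • v := by module
        rw [Set.mem_ofPred_eq, this]
        exact Submodule.sub_mem _ hPQ (Submodule.smul_mem _ _ hv)
    have := hloc.hasDerivAt_eq_zero
      (hasDerivAt_dBar hr Q v fun x hx => absurd hx (hQ0 x).ne')
    simp only [mul_add, mul_one, Finset.sum_add_distrib, sum_eq_zero_of_mem_ker hA hv,
      add_zero] at this
    rw [← this]
    exact Finset.sum_congr rfl fun x _ => by rw [Real.log_div (hQ0 x).ne' (hr x).ne']
  obtain ⟨θ, rfl⟩ := hfam
  exact ⟨θ, hPQ⟩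

/-- Duality: the divergence from the family is attained as a difference of values of `dBar r`. -/
theorem exists_infDivFrom_eq (hr : ∀ x, 0 < r x)
    (hA : (fun _ : X => (1 : ℝ)) ∈ Submodule.span ℝ (Set.range A.row)) {P : X → ℝ}
    (hP : P ∈ stdSimplex ℝ X) :
    ∃ Q ∈ stdSimplex ℝ X, P - Q ∈ LinearMap.ker A.mulVecLin ∧
      infDivFrom (family A r) P = ((dBar r P - dBar r Q : ℝ) : EReal) := by
  have : Nonempty X := by
    by_contra hX
    rw [not_nonempty_iff] at hX
    simpa using hP.2
  set R := gibbs A r 0 with hR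
  have hRs : R ∈ stdSimplex ℝ X := gibbs_mem_stdSimplex hr 0
  -- `P` may have zeros, so it is approximated by positive mixtures with `R`; the `2` keeps `ε 0 <
  -- 1`.
  let ε : ℕ → ℝ := fun n => 1 / ((n : ℝ) + 2)
  have hε0 : ∀ n, 0 < ε n := fun n => by positivity
  have hε1 : ∀ n, ε n < 1 := fun n => by
    rw [div_lt_one (by positivity)]
    have : (0 : ℝ) ≤ n := n.cast_nonneg
    linarith
  have hεt : Tendsto ε atTop (𝓝 0) := by
    have := (tendsto_one_div_add_atTop_nhds_zero_nat (𝕜 := ℝ)).comp (tendsto_add_atTop_nat 1)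
    refine this.congr fun n => ?_
    simp only [Function.comp, ε]
    push_cast
    ring
  let p : ℕ → X → ℝ := fun n => (1 - ε n) • P + ε n • R
  have hps : ∀ n, p n ∈ stdSimplex ℝ X := fun n =>
    convex_stdSimplex ℝ X hP hRs (sub_nonneg.2 (hε1 n).le) (hε0 n).le (by ring)
  have hp0 : ∀ n x, 0 < p n x := fun n x =>
    add_pos_of_nonneg_of_pos (mul_nonneg (sub_nonneg.2 (hε1 n).le) (hP.1 x))
      (mul_pos (hε0 n) (gibbs_pos hr 0 x))
  have hpt : Tendsto p atTop (𝓝 P) := by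
    simpa using ((tendsto_const_nhds (x := (1 : ℝ))).sub hεt).smul_const P |>.add
      (hεt.smul_const R)
  choose θ hθ using fun n => exists_mem_family_sub_mem_ker hr hA (hps n) (hp0 n)
  obtain ⟨Q, hQ, ns, hns, hlim⟩ := (isCompact_stdSimplex ℝ X).tendsto_subseq
    (fun n => gibbs_mem_stdSimplex (A := A) hr (θ n))
  have hPQ : P - Q ∈ LinearMap.ker A.mulVecLin :=
    (Submodule.closed_of_finiteDimensional (LinearMap.ker A.mulVecLin)).mem_of_tendsto
      ((hpt.comp hns.tendsto_atTop).sub hlim) (Eventually.of_forall fun n => hθ (ns n))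
  refine ⟨Q, hQ, hPQ, le_antisymm ?_ (dBar_sub_dBar_le_infDivFrom hr hA hP hQ hPQ)⟩
  -- The log-density of the `n`-th Gibbs measure has the same mean under that measure and under `p
  -- n`; solving for its mean under `P` and bounding the mean under `R` by `dBar r R` gives the
  -- estimate.
  have bound : ∀ n, infDivFrom (family A r) P ≤
      ((dBar r P - (dBar r (gibbs A r (θ n)) - ε n * dBar r R) / (1 - ε n) : ℝ) : EReal) := by
    intro n
    refine (iInf₂_le (gibbs A r (θ n)) ⟨θ n, rfl⟩).trans ?_
    rw [infDiv_gibbs hr hP.1, EReal.coe_le_coe_iff]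
    refine sub_le_sub_left ?_ _
    have h1 := sum_mul_log_gibbs_eq_zero hr hA (θ n) (hθ n)
    have h2 := sum_mul_log_gibbs_le_dBar (A := A) hr hRs (θ n)
    have h3 : dBar r (gibbs A r (θ n)) =
        ∑ x, gibbs A r (θ n) x * Real.log (gibbs A r (θ n) x / r x) :=
      Finset.sum_congr rfl fun x _ => by rw [abs_of_pos (gibbs_pos hr _ x)]
    have h4 : ∑ x, p n x * Real.log (gibbs A r (θ n) x / r x) =
        (1 - ε n) * ∑ x, P x * Real.log (gibbs A r (θ n) x / r x) +
          ε n * ∑ x, R x * Real.log (gibbs A r (θ n) x / r x) := by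
      rw [Finset.mul_sum, Finset.mul_sum, ← Finset.sum_add_distrib]
      refine Finset.sum_congr rfl fun x _ => ?_
      simp only [p, Pi.add_apply, Pi.smul_apply, smul_eq_mul]
      ring
    simp only [Pi.sub_apply, sub_mul, Finset.sum_sub_distrib] at h1
    rw [h4] at h1
    rw [div_le_iff₀ (sub_pos.2 (hε1 n)), h3]
    have := mul_le_mul_of_nonneg_left h2 (hε0 n).le
    linarith
  refine ge_of_tendsto' (x := atTop) ?_ fun n => bound (ns n)
  refine (continuous_coe_real_ereal.tendsto _).comp ?_
  have h5 := hεt.comp hns.tendsto_atTop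
  have h6 := (((continuous_dBar hr).tendsto Q).comp hlim).sub (h5.mul_const (dBar r R))
  have h7 := (h6.div ((tendsto_const_nhds (x := (1 : ℝ))).sub h5) (by norm_num)).const_sub
    (dBar r P)
  simpa using h7

/-! ### Lower bound for the divergence of a positive part -/

theorem posPart_apply_mul_negPart_apply {ι : Type*} (u : ι → ℝ) (x : ι) : u⁺ x * u⁻ x = 0 := by
  simp only [Pi.posPart_apply, Pi.negPart_apply, posPart_def, negPart_def]
  rcases le_total (u x) 0 with hx | hx <;> simp [hx]

theorem posPart_negPart_mem_stdSimplex
    (hA : (fun _ : X => (1 : ℝ)) ∈ Submodule.span ℝ (Set.range A.row)) {u : X → ℝ}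
    (hu : u ∈ kerSphere A) : u⁺ ∈ stdSimplex ℝ X ∧ u⁻ ∈ stdSimplex ℝ X := by
  have h1 := sum_eq_zero_of_mem_ker hA hu.1
  have h2 := hu.2
  have h3 : ∑ x, u x = ∑ x, u⁺ x - ∑ x, u⁻ x := by
    rw [← Finset.sum_sub_distrib]
    refine Finset.sum_congr rfl fun x _ => ?_
    exact (posPart_sub_negPart (u x)).symm
  have h4 : ∑ x, |u x| = ∑ x, u⁺ x + ∑ x, u⁻ x := by
    rw [← Finset.sum_add_distrib]
    refine Finset.sum_congr rfl fun x _ => ?_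
    exact (posPart_add_negPart (u x)).symm
  exact ⟨⟨fun x => posPart_nonneg (u x), by linarith⟩,
    ⟨fun x => negPart_nonneg (u x), by linarith⟩⟩

theorem mul_eq_zero_of_disjoint_support {ι : Type*} {P Q : ι → ℝ}
    (hPQ : Disjoint (Function.support P) (Function.support Q)) (x : ι) : P x * Q x = 0 := by
  by_contra hx
  exact Set.disjoint_left.1 hPQ (left_ne_zero_of_mul hx) (right_ne_zero_of_mul hx)

theorem posPart_sub_eq_left {ι : Type*} {P Q : ι → ℝ} (hP : ∀ x, 0 ≤ P x) (hQ : ∀ x, 0 ≤ Q x)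
    (hPQ : ∀ x, P x * Q x = 0) : (P - Q)⁺ = P := by
  funext x
  simp only [Pi.posPart_apply, Pi.sub_apply, posPart_def]
  rcases mul_eq_zero.1 (hPQ x) with hx | hx
  · simpa [hx] using hQ x
  · simpa [hx] using hP x

theorem sub_mem_kerSphere {P Q : X → ℝ} (hP : P ∈ stdSimplex ℝ X) (hQ : Q ∈ stdSimplex ℝ X)
    (hPQ : ∀ x, P x * Q x = 0) (hker : P - Q ∈ LinearMap.ker A.mulVecLin) :
    P - Q ∈ kerSphere A := by
  refine ⟨hker, ?_⟩
  have : ∀ x, |(P - Q) x| = P x + Q x := by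
    intro x
    rcases mul_eq_zero.1 (hPQ x) with hx | hx
    · simp [hx, abs_of_nonneg (hQ.1 x)]
    · simp [hx, abs_of_nonneg (hP.1 x)]
  simp only [this, Finset.sum_add_distrib, hP.2, hQ.2]
  norm_num

theorem dBar_mix_of_mul_eq_zero (hr : ∀ x, 0 < r x) {P Q : X → ℝ} (hP : P ∈ stdSimplex ℝ X)
    (hQ : Q ∈ stdSimplex ℝ X) (hPQ : ∀ x, P x * Q x = 0) (a b : ℝ) :
    dBar r (a • P + b • Q) =
      a * dBar r P + a * Real.log a + (b * dBar r Q + b * Real.log b) := by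
  rw [dBar_add_of_mul_eq_zero, dBar_smul hr, dBar_smul hr, hP.2, hQ.2, mul_one, mul_one]
  intro x
  simp only [Pi.smul_apply, smul_eq_mul]
  rw [mul_mul_mul_comm, hPQ, mul_zero]

theorem log_one_add_exp_dBar_le_infDivFrom (hr : ∀ x, 0 < r x)
    (hA : (fun _ : X => (1 : ℝ)) ∈ Submodule.span ℝ (Set.range A.row)) {u : X → ℝ}
    (hu : u ∈ kerSphere A) :
    ((Real.log (1 + Real.exp (dBar r u)) : ℝ) : EReal) ≤ infDivFrom (family A r) u⁺ := by
  obtain ⟨h1, h2⟩ := posPart_negPart_mem_stdSimplex hA hu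
  have hd : dBar r u = dBar r u⁺ - dBar r u⁻ := by
    conv_lhs => rw [← posPart_sub_negPart u]
    exact dBar_sub_of_mul_eq_zero r (posPart_apply_mul_negPart_apply u)
  set d := dBar r u
  have hE : 0 < 1 + Real.exp d := by positivity
  -- The weight that minimizes `dBar r` on the segment between `u⁺` and `u⁻`.
  set μ := (1 + Real.exp d)⁻¹ with hμ
  have hμ0 : 0 < μ := inv_pos.2 hE
  have hμ1 : 1 - μ = μ * Real.exp d := by
    rw [hμ]
    field_simp
    ring
  have hlog : Real.log (1 - μ) = Real.log μ + d := by
    rw [hμ1, Real.log_mul hμ0.ne' (Real.exp_pos d).ne', Real.log_exp]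
  have hlogμ : Real.log μ = -Real.log (1 + Real.exp d) := Real.log_inv _
  have hμ2 : 0 ≤ 1 - μ := by
    rw [hμ1]
    positivity
  have hker : u⁺ - (μ • u⁺ + (1 - μ) • u⁻) ∈ LinearMap.ker A.mulVecLin := by
    have : u⁺ - (μ • u⁺ + (1 - μ) • u⁻) = (1 - μ) • (u⁺ - u⁻) := by module
    rw [this, posPart_sub_negPart]
    exact Submodule.smul_mem _ _ hu.1
  refine le_trans (le_of_eq ?_) (dBar_sub_dBar_le_infDivFrom hr hA h1
    (convex_stdSimplex ℝ X h1 h2 hμ0.le hμ2 (by ring)) hker)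
  rw [dBar_mix_of_mul_eq_zero hr h1 h2 (posPart_apply_mul_negPart_apply u), hlog,
    EReal.coe_eq_coe_iff]
  have : dBar r u⁺ = d + dBar r u⁻ := by linarith
  rw [this, hlogμ]
  ring

/-! ### Upper bound over pairs in one fiber -/

/-- The log-sum inequality for `m, a` against the weights `1 - t, t`. The bound on `m` ensures `1 -
t > 0` unless `m = 0`, which is treated separately. -/
theorem add_mul_log_add_le {m a t : ℝ} (hm : 0 ≤ m) (ha : 0 ≤ a) (ht : 0 < t)
    (hmt : m ≤ 1 - t) :
    (m + a) * Real.log (m + a) ≤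
      m * Real.log m + a * Real.log a - m * Real.log (1 - t) - a * Real.log t := by
  rcases eq_or_lt_of_le hm with rfl | hm
  · have : a * Real.log t ≤ 0 := mul_nonpos_of_nonneg_of_nonpos ha
      (Real.log_nonpos ht.le (by linarith))
    simp only [zero_add, zero_mul]
    linarith
  have ht1 : 0 < 1 - t := hm.trans_le hmt
  have hma : 0 < m + a := by linarith
  have h1 := sub_le_mul_log_div hm.le (mul_pos ht1 hma)
  have h2 := sub_le_mul_log_div ha (mul_pos ht hma)
  rw [Real.log_div hm.ne' (mul_pos ht1 hma).ne', Real.log_mul ht1.ne' hma.ne'] at h1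
  have e2 : a * Real.log (a / (t * (m + a))) =
      a * (Real.log a - (Real.log t + Real.log (m + a))) := by
    rcases eq_or_ne a 0 with h | h
    · simp [h]
    · rw [Real.log_div h (mul_pos ht hma).ne', Real.log_mul ht.ne' hma.ne']
  rw [e2] at h2
  linarith

theorem exists_mem_kerSphere_dBar_sub_le (hr : ∀ x, 0 < r x)
    (hA : (fun _ : X => (1 : ℝ)) ∈ Submodule.span ℝ (Set.range A.row)) {P Q : X → ℝ}
    (hP : P ∈ stdSimplex ℝ X) (hQ : Q ∈ stdSimplex ℝ X)
    (hPQ : P - Q ∈ LinearMap.ker A.mulVecLin) (hne : P ≠ Q) :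
    ∃ u ∈ kerSphere A, dBar r P - dBar r Q ≤ Real.log (1 + Real.exp (dBar r u)) := by
  -- The total variation distance: `P` splits into mass `1 - t` shared with `Q` and excess mass `t`,
  -- and the splitting costs at most the binary entropy of `t`.
  set t := (1 / 2 : ℝ) * ∑ x, |P x - Q x| with ht
  have ht0 : 0 < t := by
    obtain ⟨y, hy⟩ := Function.ne_iff.1 hne
    have : 0 < ∑ x, |P x - Q x| := Finset.sum_pos' (fun x _ => abs_nonneg _)
      ⟨y, Finset.mem_univ y, abs_pos.2 (sub_ne_zero.2 hy)⟩
    positivity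
  have hmin : ∑ x, min (P x) (Q x) = 1 - t := by
    have : ∀ x, min (P x) (Q x) = 1 / 2 * (P x + Q x - |P x - Q x|) := by
      intro x
      rcases le_total (P x) (Q x) with hx | hx
      · rw [min_eq_left hx, abs_of_nonpos (sub_nonpos.2 hx)]
        ring
      · rw [min_eq_right hx, abs_of_nonneg (sub_nonneg.2 hx)]
        ring
    simp only [this]
    rw [← Finset.mul_sum, Finset.sum_sub_distrib, Finset.sum_add_distrib, hP.2, hQ.2, ht]
    ring
  have hpos : ∑ x, max (P x - Q x) 0 = t := by
    have : ∀ x, max (P x - Q x) 0 = P x - min (P x) (Q x) := by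
      intro x
      rcases le_total (P x) (Q x) with hx | hx <;> simp [hx]
    simp only [this, Finset.sum_sub_distrib, hmin, hP.2]
    ring
  have hmin0 : ∀ x, 0 ≤ min (P x) (Q x) := fun x => le_min (hP.1 x) (hQ.1 x)
  have hminle : ∀ x, min (P x) (Q x) ≤ 1 - t := fun x =>
    hmin ▸ Finset.single_le_sum (f := fun x => min (P x) (Q x)) (fun x _ => hmin0 x)
      (Finset.mem_univ x)
  have ht1 : t ≤ 1 := by
    have : 0 ≤ 1 - t := hmin ▸ Finset.sum_nonneg fun x _ => hmin0 x
    linarith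
  refine ⟨t⁻¹ • (P - Q), ⟨Submodule.smul_mem _ _ hPQ, ?_⟩, ?_⟩
  · simp only [Pi.smul_apply, Pi.sub_apply, smul_eq_mul, abs_mul, abs_of_pos (inv_pos.2 ht0)]
    rw [← Finset.mul_sum, mul_left_comm, ← ht, inv_mul_cancel₀ ht0.ne']
  · refine le_trans ?_ (mul_add_entropy_le_log_one_add_exp _ ht0.le ht1)
    rw [dBar_smul hr, sum_eq_zero_of_mem_ker hA hPQ, mul_zero, add_zero, ← mul_assoc,
      mul_inv_cancel₀ ht0.ne', one_mul]
    have key : dBar r P - dBar r Q - dBar r (P - Q) ≤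
        ∑ x, (-(max (P x - Q x) 0 * Real.log t) - min (P x) (Q x) * Real.log (1 - t)) := by
      rw [dBar_eq_sum hr, dBar_eq_sum hr, dBar_eq_sum hr, ← Finset.sum_sub_distrib,
        ← Finset.sum_sub_distrib]
      refine Finset.sum_le_sum fun x _ => ?_
      simp only [Pi.sub_apply]
      have hmx := hminle x
      rcases le_total (Q x) (P x) with hx | hx
      · rw [min_eq_right hx] at hmx ⊢
        rw [max_eq_left (sub_nonneg.2 hx)]
        have := add_mul_log_add_le (hQ.1 x) (sub_nonneg.2 hx) ht0 hmx
        rw [add_sub_cancel] at this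
        linarith
      -- Here there is no excess, and superadditivity `P log P + (Q - P) log (Q - P) ≤ Q log Q` is
      -- enough.
      · rw [min_eq_left hx] at hmx ⊢
        rw [max_eq_right (sub_nonpos.2 hx)]
        have hsymm : Real.log (P x - Q x) = Real.log (Q x - P x) := by
          rw [← Real.log_neg_eq_log, neg_sub]
        have h1 : 0 ≤ -(P x * Real.log (1 - t)) := by
          have := mul_nonpos_of_nonneg_of_nonpos (hP.1 x)
            (Real.log_nonpos (by linarith [hP.1 x] : (0 : ℝ) ≤ 1 - t) (by linarith))
          linarith
        have h2 : ∀ a b : ℝ, 0 ≤ a → a ≤ b → a * Real.log a ≤ a * Real.log b := by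
          intro a b ha hab
          rcases eq_or_lt_of_le ha with rfl | ha
          · simp
          · exact mul_le_mul_of_nonneg_left (Real.log_le_log ha hab) ha.le
        have h3 := h2 _ _ (hP.1 x) hx
        have h4 := h2 (Q x - P x) (Q x) (sub_nonneg.2 hx) (by linarith [hP.1 x])
        rw [hsymm]
        linarith
    rw [Finset.sum_sub_distrib, Finset.sum_neg_distrib, ← Finset.sum_mul, ← Finset.sum_mul, hmin,
      hpos] at key
    linarith

/-! ### Global maximizers -/

theorem isGlobalMaxDiv_posPart (hr : ∀ x, 0 < r x)
    (hA : (fun _ : X => (1 : ℝ)) ∈ Submodule.span ℝ (Set.range A.row)) {u : X → ℝ}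
    (hu : IsGlobalMaxDBar A r u) : IsGlobalMaxDiv (family A r) u⁺ := by
  refine ⟨(posPart_negPart_mem_stdSimplex hA hu.1).1, fun P hP => ?_⟩
  refine le_trans ?_ (log_one_add_exp_dBar_le_infDivFrom hr hA hu.1)
  obtain ⟨Q, hQ, hPQ, hD⟩ := exists_infDivFrom_eq hr hA hP
  rw [hD, EReal.coe_le_coe_iff]
  rcases eq_or_ne P Q with rfl | hne
  · rw [sub_self]
    exact Real.log_nonneg (by linarith [Real.exp_pos (dBar r u)])
  · obtain ⟨v, hv, hle⟩ := exists_mem_kerSphere_dBar_sub_le hr hA hP hQ hPQ hne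
    refine hle.trans (Real.log_le_log (by positivity) ?_)
    have := Real.exp_le_exp.2 (hu.2 hv)
    linarith

/-! ### Local maximizers of the divergence and their partners -/

/-- Otherwise `D ≤ 0` near `P`, so at a nearby interior point `p` duality makes `dBar r` locally
maximal along `ker A`, against strict convexity along `± v`. -/
theorem infDivFrom_pos_of_isLocalMaxDiv (hr : ∀ x, 0 < r x)
    (hA : (fun _ : X => (1 : ℝ)) ∈ Submodule.span ℝ (Set.range A.row))
    (hker : LinearMap.ker A.mulVecLin ≠ ⊥) {P : X → ℝ}
    (hP : IsLocalMaxDiv (family A r) P) : 0 < infDivFrom (family A r) P := by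
  by_contra hD
  rw [not_lt] at hD
  obtain ⟨v, hv, hv0⟩ := (Submodule.ne_bot_iff _).1 hker
  have : Nonempty X := by
    by_contra hX
    rw [not_nonempty_iff] at hX
    simpa using hP.1.2
  obtain ⟨U, hU, hPU, hUD⟩ := mem_nhdsWithin.1 hP.2
  set R := gibbs A r 0
  have hRs : R ∈ stdSimplex ℝ X := gibbs_mem_stdSimplex hr 0
  have hcont : Continuous fun ε : ℝ => (1 - ε) • P + ε • R := by fun_prop
  have hev : ∀ᶠ ε : ℝ in 𝓝[>] 0, (1 - ε) • P + ε • R ∈ U := by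
    refine nhdsWithin_le_nhds ((hcont.tendsto 0).eventually (hU.mem_nhds ?_))
    simpa using hPU
  obtain ⟨ε, hεU, hε0, hε1⟩ :=
    (hev.and (Ioo_mem_nhdsGT (zero_lt_one (α := ℝ)))).exists
  set p := (1 - ε) • P + ε • R with hp
  have hps : p ∈ stdSimplex ℝ X :=
    convex_stdSimplex ℝ X hP.1 hRs (sub_nonneg.2 hε1.le) hε0.le (by ring)
  have hp0 : ∀ x, 0 < p x := fun x =>
    add_pos_of_nonneg_of_pos (mul_nonneg (sub_nonneg.2 hε1.le) (hP.1.1 x))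
      (mul_pos hε0 (gibbs_pos hr 0 x))
  have hgood : ∀ w ∈ LinearMap.ker A.mulVecLin, ∀ᶠ s : ℝ in 𝓝 0,
      dBar r (p + s • w) ≤ dBar r p ∧ ∀ x, 0 ≤ (p + s • w) x := by
    intro w hw
    have hcont : Continuous fun s : ℝ => p + s • w := by fun_prop
    have h1 : ∀ᶠ s : ℝ in 𝓝 0, p + s • w ∈ U :=
      (hcont.tendsto 0).eventually (hU.mem_nhds (by simpa using hεU))
    filter_upwards [h1, eventually_add_smul_nonneg (v := w) hps.1
      fun x hx => absurd hx (hp0 x).ne'] with s hsU hs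
    have hss : p + s • w ∈ stdSimplex ℝ X := ⟨hs, by
      simp [Finset.sum_add_distrib, ← Finset.mul_sum, sum_eq_zero_of_mem_ker hA hw, hps.2]⟩
    refine ⟨?_, hs⟩
    have h2 := dBar_sub_dBar_le_infDivFrom hr hA hss hps
      (by simpa using Submodule.smul_mem _ s hw)
    have h3 := (h2.trans (hUD ⟨hsU, hss⟩)).trans hD
    have h4 : dBar r (p + s • w) - dBar r p ≤ 0 := by exact_mod_cast h3
    linarith
  have hboth := ((hgood v hv).and (hgood (-v) (Submodule.neg_mem _ hv))).filter_mono
    (nhdsWithin_le_nhds (s := Set.Ioi (0 : ℝ)))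
  obtain ⟨s, ⟨⟨ha, ha0⟩, hb, hb0⟩, hs⟩ := (hboth.and self_mem_nhdsWithin).exists
  have hs : (0 : ℝ) < s := hs
  have hne : p + s • v ≠ p + s • (-v) := by
    intro h
    have h1 := add_left_cancel h
    have h2 := smul_right_injective (X → ℝ) hs.ne' h1
    exact hv0 (self_eq_neg.1 h2)
  have h1 := (strictConvexOn_dBar hr).2 ha0 hb0 hne (one_half_pos (α := ℝ)) one_half_pos
    (add_halves 1)
  have h2 : (1 / 2 : ℝ) • (p + s • v) + (1 / 2 : ℝ) • (p + s • (-v)) = p := by module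
  rw [h2] at h1
  simp only [smul_eq_mul] at h1
  linarith

theorem exists_partner_infDivFrom_eq (hr : ∀ x, 0 < r x)
    (hA : (fun _ : X => (1 : ℝ)) ∈ Submodule.span ℝ (Set.range A.row))
    (hker : LinearMap.ker A.mulVecLin ≠ ⊥) {P : X → ℝ} (hP : IsLocalMaxDiv (family A r) P) :
    ∃ Pm ∈ stdSimplex ℝ X, Disjoint (Function.support P) (Function.support Pm) ∧
      P - Pm ∈ kerSphere A ∧ infDivFrom (family A r) P =
        ((Real.log (1 + Real.exp (dBar r (P - Pm))) : ℝ) : EReal) := by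
  classical
  obtain ⟨Q, hQ, hPQ, hD⟩ := exists_infDivFrom_eq hr hA hP.1
  have hne : P ≠ Q := by
    rintro rfl
    have := infDivFrom_pos_of_isLocalMaxDiv hr hA hker hP
    rw [hD, sub_self] at this
    exact lt_irrefl _ this
  have hsupp : ∀ x, Q x = 0 → P x = 0 := by
    intro x hx
    refine support_subset_of_forall_dBar_le hr hP.1 hQ (fun s h0 h1 => ?_) hx
    have h2 : P - ((1 - s) • Q + s • P) ∈ LinearMap.ker A.mulVecLin := by
      have : P - ((1 - s) • Q + s • P) = (1 - s) • (P - Q) := by module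
      rw [this]
      exact Submodule.smul_mem _ _ hPQ
    have h3 := dBar_sub_dBar_le_infDivFrom hr hA hP.1
      (convex_stdSimplex ℝ X hQ hP.1 (sub_nonneg.2 h1.le) h0.le (by ring)) h2
    rw [hD, EReal.coe_le_coe_iff] at h3
    linarith
  have hprop : ∀ x y, P x ≠ 0 → P y ≠ 0 →
      Real.log (P x) - Real.log (Q x) = Real.log (P y) - Real.log (Q y) := by
    intro x y hx hy
    -- Shifting `P` and `Q` by the same vector preserves `P - Q`, so `w` need not lie in `ker A`.
    set w : X → ℝ := Pi.single x 1 - Pi.single y 1 with hw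
    have hwsum : ∑ z, w z = 0 := by simp [hw]
    have hwP : ∀ z, P z = 0 → w z = 0 := by
      intro z hz
      have h1 : z ≠ x := fun h => hx (h ▸ hz)
      have h2 : z ≠ y := fun h => hy (h ▸ hz)
      simp [hw, h1, h2]
    have hwQ : ∀ z, Q z = 0 → w z = 0 := fun z hz => hwP z (hsupp z hz)
    have hcont : Continuous fun s : ℝ => P + s • w := by fun_prop
    have hmem : ∀ (R : X → ℝ) (s : ℝ), R ∈ stdSimplex ℝ X → (∀ z, 0 ≤ (R + s • w) z) →
        R + s • w ∈ stdSimplex ℝ X := fun R s hR hs =>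
      ⟨hs, by simp [Finset.sum_add_distrib, ← Finset.mul_sum, hwsum, hR.2]⟩
    have hloc : IsLocalMax (fun s : ℝ => dBar r (P + s • w) - dBar r (Q + s • w)) 0 := by
      have h1 : ∀ᶠ s : ℝ in 𝓝 0, P + s • w ∈ stdSimplex ℝ X →
          infDivFrom (family A r) (P + s • w) ≤ infDivFrom (family A r) P := by
        have h2 := (eventually_nhdsWithin_iff.1 hP.2)
        exact (hcont.tendsto' 0 P (by simp)).eventually h2
      filter_upwards [h1, eventually_add_smul_nonneg hP.1.1 hwP,
        eventually_add_smul_nonneg hQ.1 hwQ] with s hs1 hsP hsQ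
      have h2 := dBar_sub_dBar_le_infDivFrom (P := P + s • w) (Q := Q + s • w) hr hA
        (hmem P s hP.1 hsP) (hmem Q s hQ hsQ) (by simpa using hPQ)
      have h3 := h2.trans (hs1 (hmem P s hP.1 hsP))
      rw [hD, EReal.coe_le_coe_iff] at h3
      simpa using h3
    have h4 := hloc.hasDerivAt_eq_zero
      ((hasDerivAt_dBar hr P w hwP).sub (hasDerivAt_dBar hr Q w hwQ))
    rw [← Finset.sum_sub_distrib] at h4
    simp only [hw, Pi.sub_apply, sub_mul, Finset.sum_sub_distrib, Pi.single_apply, ite_mul,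
      one_mul, zero_mul, Finset.sum_ite_eq', Finset.mem_univ, if_true] at h4
    linarith
  obtain ⟨y, hy⟩ : ∃ y, P y ≠ 0 := by
    by_contra! hall
    simpa [hall] using hP.1.2
  have hQpos : ∀ x, P x ≠ 0 → 0 < Q x := fun x hx =>
    lt_of_le_of_ne (hQ.1 x) fun h => hx (hsupp x h.symm)
  have hPpos : ∀ x, P x ≠ 0 → 0 < P x := fun x hx => lt_of_le_of_ne (hP.1.1 x) hx.symm
  set q := Q y / P y with hq
  have hq0 : 0 < q := div_pos (hQpos y hy) (hPpos y hy)
  have hQq : ∀ x, P x ≠ 0 → Q x = q * P x := by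
    intro x hx
    refine Real.log_injOn_pos (hQpos x hx) (mul_pos hq0 (hPpos x hx)) ?_
    rw [Real.log_mul hq0.ne' hx, hq, Real.log_div (hQpos y hy).ne' hy]
    linarith [hprop x y hx hy]
  have hnn : ∀ x, 0 ≤ Q x - q * P x := by
    intro x
    rcases eq_or_ne (P x) 0 with hx | hx
    · simpa [hx] using hQ.1 x
    · rw [hQq x hx, sub_self]
  have hsum : ∑ x, (Q x - q * P x) = 1 - q := by
    rw [Finset.sum_sub_distrib, ← Finset.mul_sum, hQ.2, hP.1.2, mul_one]
  have hq1 : q < 1 := by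
    refine lt_of_le_of_ne ?_ fun h1 => hne ?_
    · have : 0 ≤ 1 - q := hsum ▸ Finset.sum_nonneg fun x _ => hnn x
      linarith
    · rw [h1, sub_self] at hsum
      funext x
      have := (Finset.sum_eq_zero_iff_of_nonneg fun x _ => h1 ▸ hnn x).1 hsum x
        (Finset.mem_univ x)
      linarith
  have hq' : 0 < 1 - q := sub_pos.2 hq1
  -- The part of `Q` off the support of `P`, normalized.
  set Pm : X → ℝ := (1 - q)⁻¹ • (Q - q • P) with hPm
  have hPms : Pm ∈ stdSimplex ℝ X := by
    refine ⟨fun x => mul_nonneg (inv_pos.2 hq').le (hnn x), ?_⟩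
    have : ∀ x, Pm x = (1 - q)⁻¹ * (Q x - q * P x) := fun x => rfl
    simp only [this]
    rw [← Finset.mul_sum, hsum, inv_mul_cancel₀ hq'.ne']
  have hmul : ∀ x, P x * Pm x = 0 := by
    intro x
    rcases eq_or_ne (P x) 0 with hx | hx
    · simp [hx]
    · simp [hPm, hQq x hx]
  have hmix : q • P + (1 - q) • Pm = Q := by
    rw [hPm, smul_inv_smul₀ hq'.ne']
    module
  have hsub : P - Pm = (1 - q)⁻¹ • (P - Q) := by
    rw [← hmix]
    have : P - (q • P + (1 - q) • Pm) = (1 - q) • (P - Pm) := by module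
    rw [this, inv_smul_smul₀ hq'.ne']
  have hsphere : P - Pm ∈ kerSphere A :=
    sub_mem_kerSphere hP.1 hPms hmul (hsub ▸ Submodule.smul_mem _ _ hPQ)
  refine ⟨Pm, hPms, ?_, hsphere, le_antisymm ?_ ?_⟩
  · rw [Set.disjoint_left]
    intro x hx hx'
    exact mul_ne_zero hx hx' (hmul x)
  -- With `Q = q P + (1 - q) Pm`, this is the binary entropy bound at `t = 1 - q`.
  · rw [hD, EReal.coe_le_coe_iff, dBar_sub_of_mul_eq_zero r hmul, ← hmix,
      dBar_mix_of_mul_eq_zero hr hP.1 hPms hmul]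
    have := mul_add_entropy_le_log_one_add_exp (dBar r P - dBar r Pm) hq'.le (by linarith)
    rw [sub_sub_cancel] at this
    linarith
  · have := log_one_add_exp_dBar_le_infDivFrom hr hA hsphere
    rwa [posPart_sub_eq_left hP.1.1 hPms.1 hmul] at this

/-! ### Transfer of maximality and uniqueness of the partner -/

theorem le_of_coe_log_one_add_exp_le {a b : ℝ}
    (hab : ((Real.log (1 + Real.exp a) : ℝ) : EReal) ≤
      ((Real.log (1 + Real.exp b) : ℝ) : EReal)) : a ≤ b := by
  rw [EReal.coe_le_coe_iff, Real.log_le_log_iff (by positivity) (by positivity)] at hab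
  exact Real.exp_le_exp.1 (by linarith)

theorem continuous_posPart_pi {ι : Type*} : Continuous fun u : ι → ℝ => u⁺ := by
  refine continuous_pi fun x => ?_
  simp only [Pi.posPart_apply, posPart_def]
  exact (continuous_apply x).max continuous_const

/-- For `v` near `u` on the sphere, `log (1 + exp (dBar r v)) ≤ D(v⁺‖𝓔) ≤ D(u⁺‖𝓔) = log (1 + exp
(dBar r u))`. -/
theorem isLocalMaxDBar_of_infDivFrom_eq (hr : ∀ x, 0 < r x)
    (hA : (fun _ : X => (1 : ℝ)) ∈ Submodule.span ℝ (Set.range A.row)) {u : X → ℝ}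
    (hu : u ∈ kerSphere A) (hP : IsLocalMaxDiv (family A r) u⁺)
    (hD : infDivFrom (family A r) u⁺ = ((Real.log (1 + Real.exp (dBar r u)) : ℝ) : EReal)) :
    IsLocalMaxDBar A r u := by
  refine ⟨hu, ?_⟩
  have h1 : Tendsto (fun v : X → ℝ => v⁺) (𝓝[kerSphere A] u) (𝓝[stdSimplex ℝ X] u⁺) :=
    continuous_posPart_pi.continuousWithinAt.tendsto_nhdsWithin
      fun v hv => (posPart_negPart_mem_stdSimplex hA hv).1
  filter_upwards [h1.eventually hP.2, self_mem_nhdsWithin] with v hv hvs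
  refine le_of_coe_log_one_add_exp_le ?_
  rw [← hD]
  exact (log_one_add_exp_dBar_le_infDivFrom hr hA hvs).trans hv

/-- Local maximality of `P - Q` forces `Q` to have a strictly smaller `dBar r` than any other partner of `P`. -/
theorem dBar_lt_of_isPartner (hr : ∀ x, 0 < r x) {P Q Q' : X → ℝ}
    (hP : P ∈ stdSimplex ℝ X) (hQ : IsPartner A r P Q) (hQ' : IsPartner A r P Q')
    (hne : Q ≠ Q') : dBar r Q < dBar r Q' := by
  have hm := mul_eq_zero_of_disjoint_support hQ.2.1
  have hm' := mul_eq_zero_of_disjoint_support hQ'.2.1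
  have hcont : Continuous fun s : ℝ => P - ((1 - s) • Q + s • Q') := by fun_prop
  have hmaps : ∀ s ∈ Set.Ioo (0 : ℝ) 1, (∀ x, P x * ((1 - s) • Q + s • Q') x = 0) ∧
      P - ((1 - s) • Q + s • Q') ∈ kerSphere A := by
    intro s hs
    have h1 : ∀ x, P x * ((1 - s) • Q + s • Q') x = 0 := by
      intro x
      simp only [Pi.add_apply, Pi.smul_apply, smul_eq_mul]
      linear_combination (1 - s) * hm x + s * hm' x
    refine ⟨h1, sub_mem_kerSphere hP (convex_stdSimplex ℝ X hQ.1 hQ'.1 (sub_nonneg.2 hs.2.le)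
      hs.1.le (by ring)) h1 ?_⟩
    have : P - ((1 - s) • Q + s • Q') = (1 - s) • (P - Q) + s • (P - Q') := by module
    rw [this]
    exact Submodule.add_mem _ (Submodule.smul_mem _ _ hQ.2.2.1.1)
      (Submodule.smul_mem _ _ hQ'.2.2.1.1)
  have hev : ∀ᶠ s : ℝ in 𝓝[>] 0, P - ((1 - s) • Q + s • Q') ∈ kerSphere A →
      dBar r (P - ((1 - s) • Q + s • Q')) ≤ dBar r (P - Q) := by
    have h2 := eventually_nhdsWithin_iff.1 hQ.2.2.2
    exact ((hcont.tendsto' 0 (P - Q) (by simp)).eventually h2).filter_mono nhdsWithin_le_nhds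
  obtain ⟨s, hs, hs01⟩ := (hev.and (Ioo_mem_nhdsGT (zero_lt_one (α := ℝ)))).exists
  obtain ⟨h1, h2⟩ := hmaps s hs01
  have h3 := hs h2
  rw [dBar_sub_of_mul_eq_zero r h1, dBar_sub_of_mul_eq_zero r hm] at h3
  have h4 := (strictConvexOn_dBar hr).2 hQ.1.1 hQ'.1.1 hne (sub_pos.2 hs01.2) hs01.1
    (by ring)
  simp only [smul_eq_mul] at h4
  have h5 : s * dBar r Q < s * dBar r Q' := by linarith
  exact lt_of_mul_lt_mul_left h5 hs01.1.le

theorem IsPartner.eq (hr : ∀ x, 0 < r x) {P Q Q' : X → ℝ}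
    (hP : P ∈ stdSimplex ℝ X) (hQ : IsPartner A r P Q) (hQ' : IsPartner A r P Q') :
    Q = Q' := by
  by_contra hne
  exact lt_asymm (dBar_lt_of_isPartner hr hP hQ hQ' hne)
    (dBar_lt_of_isPartner hr hP hQ' hQ (Ne.symm hne))

end

end ExpFamily

/-! ### The theorem -/

theorem theorem1 {X : Type*} [Fintype X] {h : ℕ} (A : Matrix (Fin h) X ℝ) (r : X → ℝ)
    (hr : ∀ x, 0 < r x)
    (hA : (fun _ : X => (1 : ℝ)) ∈ Submodule.span ℝ (Set.range A.row)) :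
    (∀ u : X → ℝ, ExpFamily.IsGlobalMaxDBar A r u →
      ExpFamily.IsGlobalMaxDiv (ExpFamily.family A r) (u⁺)) ∧
    (LinearMap.ker A.mulVecLin ≠ ⊥ →
      ∀ Pp : X → ℝ, ExpFamily.IsLocalMaxDiv (ExpFamily.family A r) Pp →
        (∃! Pm : X → ℝ, ExpFamily.IsPartner A r Pp Pm) ∧
        (ExpFamily.IsGlobalMaxDiv (ExpFamily.family A r) Pp →
          ∀ Pm : X → ℝ, ExpFamily.IsPartner A r Pp Pm →
            ExpFamily.IsGlobalMaxDBar A r (Pp - Pm))) := by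
  open ExpFamily in
  refine ⟨fun u hu => isGlobalMaxDiv_posPart hr hA hu, fun hker Pp hPp => ?_⟩
  obtain ⟨Q, hQ, hdisj, hsphere, hD⟩ := exists_partner_infDivFrom_eq hr hA hker hPp
  have hpos : (Pp - Q)⁺ = Pp :=
    posPart_sub_eq_left hPp.1.1 hQ.1 (mul_eq_zero_of_disjoint_support hdisj)
  have hpartner : IsPartner A r Pp Q := ⟨hQ, hdisj,
    isLocalMaxDBar_of_infDivFrom_eq hr hA hsphere (hpos.symm ▸ hPp) (hpos.symm ▸ hD)⟩
  refine ⟨⟨Q, hpartner, fun Q' hQ' => hQ'.eq hr hPp.1 hpartner⟩, fun hglob Pm hPm => ?_⟩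
  obtain rfl := hPm.eq hr hPp.1 hpartner
  refine ⟨hsphere, fun v hv => le_of_coe_log_one_add_exp_le ?_⟩
  rw [← hD]
  exact (log_one_add_exp_dBar_le_infDivFrom hr hA hv).trans
    (hglob.2 (posPart_negPart_mem_stdSimplex hA hv).1)
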